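/- Let $S^2_4$ be the boundary complex of the tetrahedron with vertices $x_1,x_2,x_3,x_4$, and let the cell complex $S^2_4\times S^2_4$ consist of the cells $A\times B$, where $A$ and $B$ run over the (carriers of the) simplices of $S^2_4$ spanned by nonempty proper subsets of $\{x_1,\dots,x_4\}$; write $x_{ij}=(x_i,x_j)$ for its vertices. A simplicial subdivision of a cell complex is a geometric simplicial complex with the same carrier, each of whose simplices lies in a cell. The action of a group $G$ of simplicial automorphisms on a simplicial complex $X$ is called pure if (a) $uv$ is a non-edge of $X$ whenever $u\ne v$ are vertices in the same $G$-orbit, and (b) for each $G$-orbit $\theta$ of vertices and each simplex $\sigma$ of $X$ (including the empty one), the setwise stabiliser $G_\sigma$ acts transitively on the intersection of $\theta$ with the vertex set of the link of $\sigma$ in $X$. Let $(S^2\times S^2)_{16}$ be the simplicial complex on the vertices $x_{ij}$, $1\le i,j\le 4$, whose facets are the images of the five sets $$x_{11}x_{22}x_{33}x_{12}x_{13},\quad x_{11}x_{22}x_{12}x_{14}x_{34},\quad x_{11}x_{22}x_{14}x_{24}x_{34},\quad x_{11}x_{22}x_{21}x_{24}x_{31},\quad x_{11}x_{22}x_{24}x_{31}x_{34}$$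 under the group $A_4\times\mathbb Z_2$, where $A_4$ acts on the indices and $\mathbb Z_2$ by $x_{ij}\leftrightarrow x_{ji}$. Theorem. There are exactly two 16-vertex simplicial complexes which (i) are simplicial subdivisions of the cell complex $S^2_4\times S^2_4$, (ii) have the coordinate flip $\alpha:(x,y)\mapsto(y,x)$ as a simplicial automorphism, and (iii) are such that the action of $\mathbb Z_2=\langle\alpha\rangle$ on them is pure. These two complexes are isomorphic, one of them is $(S^2\times S^2)_{16}$, and $(S^2\times S^2)_{16}$ has face vector $(16,84,216,240,96)$. -/

import Mathlib

/-- The vertices of an abstract simplicial complex. (In Mathlib's convention the empty simplex is not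
listed among the faces.) -/
def vertexSet {V : Type*} (X : PreAbstractSimplicialComplex V) : Set V :=
  {v | {v} ∈ X.faces}

/-- Two simplicial complexes are isomorphic if some map that is injective on the vertices of the
first one carries its simplices exactly onto the simplices of the second one. -/
def IsIsomorphic {V W : Type*} [DecidableEq W]
    (X : PreAbstractSimplicialComplex V) (Y : PreAbstractSimplicialComplex W) : Prop :=
  ∃ f : V → W, Set.InjOn f (vertexSet X) ∧ X.map f = Y

/-- The bijection `g` of the ambient set of vertices is a simplicial automorphism of `X`:
it carries the set of simplices of `X` onto itself. -/
def IsSimplicialAutomorphism {V : Type*} [DecidableEq V]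
    (X : PreAbstractSimplicialComplex V) (g : Equiv.Perm V) : Prop :=
  X.map g = X

/-- The vertices of the link of `s` in `X`; for `s = ∅` these are the vertices of `X`. -/
def linkVertices {V : Type*} [DecidableEq V]
    (X : PreAbstractSimplicialComplex V) (s : Finset V) : Set V :=
  {v | v ∉ s ∧ insert v s ∈ X.faces}

/-- The action on `X` of a group `G` of simplicial automorphisms is pure: distinct vertices in the
same orbit are not joined by an edge, and for every simplex `s` (the empty one included) the
(setwise) stabiliser of `s` acts transitively on the intersection of each orbit of vertices with the
set of vertices of the link of `s`. -/
structure IsPureAction {V : Type*} [DecidableEq V]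
    (G : Subgroup (Equiv.Perm V)) (X : PreAbstractSimplicialComplex V) : Prop where
  automorphism : ∀ g ∈ G, IsSimplicialAutomorphism X g
  not_edge : ∀ u ∈ vertexSet X, ∀ v ∈ vertexSet X, u ≠ v → (∃ g ∈ G, g u = v) →
    ({u, v} : Finset V) ∉ X.faces
  transitive : ∀ s : Finset V, (s = ∅ ∨ s ∈ X.faces) →
    ∀ u ∈ linkVertices X s, ∀ v ∈ linkVertices X s, (∃ g ∈ G, g u = v) →
      ∃ g ∈ G, s.image g = s ∧ g u = v

/-- `X` has dimension `d` and exactly `f i` simplices of dimension `i`, for `0 ≤ i ≤ d`. -/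
def HasFaceVector {V : Type*} (X : PreAbstractSimplicialComplex V) {d : ℕ}
    (f : Fin (d + 1) → ℕ) : Prop :=
  (∀ s ∈ X.faces, s.card ≤ d + 1) ∧ (∃ s ∈ X.faces, s.card = d + 1) ∧
    ∀ i : Fin (d + 1), {s ∈ X.faces | s.card = (i : ℕ) + 1}.encard = (f i : ℕ∞)

/-- The geometric simplicial complex `K` is a simplicial subdivision of the cell complex with the
set of (closed, convex) cells `C`: it has the same carrier, and each of its simplices lies in a
cell. -/
def IsSimplicialSubdivision {E : Type*} [AddCommGroup E] [Module ℝ E]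
    (K : Geometry.SimplicialComplex ℝ E) (C : Set (Set E)) : Prop :=
  K.space = ⋃₀ C ∧ ∀ s ∈ K.faces, ∃ c ∈ C, convexHull ℝ (s : Set E) ⊆ c

/-- The geometric carrier of the simplex with vertex set `A`, as a face of the standard
tetrahedron in `ℝ⁴`: the barycentric coordinate functions supported in `A`. -/
def simplexCarrier (A : Finset (Fin 4)) : Set (Fin 4 → ℝ) :=
  {p | p ∈ stdSimplex ℝ (Fin 4) ∧ ∀ i, i ∉ A → p i = 0}

/-- The cells `|A| × |B|` of the product cell complex `S²₄ × S²₄`, where `S²₄` is the boundary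
complex of the tetrahedron: `A` and `B` run over the nonempty proper subsets of the set of four
vertices. -/
def productCells : Set (Set ((Fin 4 → ℝ) × (Fin 4 → ℝ))) :=
  {c | ∃ A B : Finset (Fin 4), A.Nonempty ∧ A ≠ Finset.univ ∧ B.Nonempty ∧ B ≠ Finset.univ ∧
    c = simplexCarrier A ×ˢ simplexCarrier B}

/-- The vertex `(x_i, x_j)` of `S²₄ × S²₄`. -/
noncomputable def productVertex (v : Fin 4 × Fin 4) : (Fin 4 → ℝ) × (Fin 4 → ℝ) :=
  (Pi.single v.1 1, Pi.single v.2 1)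

/-- The coordinate flip `(x, y) ↦ (y, x)`. -/
def coordinateFlip : Equiv.Perm ((Fin 4 → ℝ) × (Fin 4 → ℝ)) :=
  Equiv.prodComm (Fin 4 → ℝ) (Fin 4 → ℝ)

/-- The five basic facets of `(S² × S²)₁₆`; the vertex called `x_{ij}` with `1 ≤ i, j ≤ 4` is the pair
`(i - 1, j - 1)` here. -/
def basicFacets : Finset (Finset (Fin 4 × Fin 4)) :=
  {{(0, 0), (1, 1), (2, 2), (0, 1), (0, 2)},
   {(0, 0), (1, 1), (0, 1), (0, 3), (2, 3)},
   {(0, 0), (1, 1), (0, 3), (1, 3), (2, 3)},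
   {(0, 0), (1, 1), (1, 0), (1, 3), (2, 0)},
   {(0, 0), (1, 1), (1, 3), (2, 0), (2, 3)}}

/-- The facets of `(S² × S²)₁₆`: the images of the basic facets under `A₄ × ℤ₂`, where `A₄` acts on the
indices and `ℤ₂` interchanges the two indices. -/
def s2s2Facets : Set (Finset (Fin 4 × Fin 4)) :=
  {t | ∃ σ ∈ alternatingGroup (Fin 4), ∃ b ∈ basicFacets,
    t = b.image (Prod.map σ σ) ∨ t = (b.image (Prod.map σ σ)).image Prod.swap}

/-- The abstract simplicial complex `(S² × S²)₁₆`. -/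
def s2s2 : PreAbstractSimplicialComplex (Fin 4 × Fin 4) where
  faces := {s | s.Nonempty ∧ ∃ t ∈ s2s2Facets, s ⊆ t}
  isRelLowerSet_faces := by
    rintro s ⟨hs, t, ht, hst⟩
    exact ⟨hs, fun r hrs hr => ⟨hr, t, ht, subset_trans hrs hst⟩⟩

/-!
The proof turns on the fact that all the complexes in question are flag within cells, and that a
point of a product of two simplices is described by its transport plans.

Identify the vertex `x_{ij}` with the pair `(i, j)`. For each sign `ε` the graph `adj ε` joins two
pairs if they share an index in the same position or if one of them is diagonal; `x_{ij}` and
`x_{kl}` with `i, j, k, l` distinct are joined iff the permutation `ijkl` has the parity prescribed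
by `ε`; no other pairs are joined. The triangulation `cliqueTriangulation ε` consists of the cliques
of this graph that lie in a cell.

*It is a triangulation.* A way to write a point `(x, y)` as a convex combination of the vertices is
a nonnegative `4 × 4` matrix with marginals `x` and `y`. Two such matrices supported on cliques in
cells agree: their difference has zero marginals, so if it were nonzero it would contain an
alternating square or hexagon whose positive and negative halves are both cliques, and there is none
(`eq_zero_of_adj_of_sum_eq_zero`). This gives affine independence and the intersection property. A
matrix supported on a clique exists because a minimiser of a suitable linear cost on the polytope of
matrices with given marginals has such a support: two non-adjacent entries of a cell could be
exchanged for the other diagonal of their square at a smaller cost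
(`exists_isTransportPlan_isCellClique`).

*There are no others.* The vertices of a 16-vertex subdivision are the extreme points `x_{ij}` of the
cells. Every square contains one of its two diagonals as an edge (`isEdge_or_isEdge`). Purity forbids
the edges `x_{ij}x_{ji}` and `x_{ij}x_{ki}`, and lets at most one of `x_{ij}x_{kl}` and `x_{ji}x_{kl}`
be an edge; together with the squares this propagates one edge `x_{ij}x_{kl}` with distinct indices to
all those of the same parity and excludes those of the other parity. So the complex is contained in
`cliqueTriangulation ε` for some `ε` (`exists_forall_isEdge_adj`), and two complexes with the same
carrier, one contained in the other, are equal (`eq_cliqueTriangulation`).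

The two triangulations are exchanged by an odd permutation of the indices, and `(S² × S²)₁₆` is the
one for even permutations (`mem_s2s2_faces_iff`); this and its face vector come from an enumeration
of cliques.
-/

/-! ### The two graphs on the vertices -/

/-- For distinct `i, j, k, l`: the permutation `0 ↦ i, 1 ↦ j, 2 ↦ k, 3 ↦ l` is even. It is computed
as the parity of the number of inversions. -/
def evenIndices (i j k l : Fin 4) : Bool :=
  !((decide (j < i)) ^^ (decide (k < i)) ^^ (decide (l < i)) ^^
    (decide (k < j)) ^^ (decide (l < j)) ^^ (decide (l < k)))

/-- The graph, with loops, on the vertices `x_{ij}` that is the 1-skeleton of one of the two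
triangulations; `ε = true` stands for the edges `x_{ij}x_{kl}` with `ijkl` an even permutation.
Vertices `x_{ij}`, `x_{kl}` off the diagonal with `i ≠ k`, `j ≠ l` and `i = l` or `j = k` are not
joined. -/
def adj (ε : Bool) (u v : Fin 4 × Fin 4) : Bool :=
  decide (u.1 = v.1) || decide (u.2 = v.2) || decide (u.1 = u.2) || decide (v.1 = v.2) ||
    (decide (u.1 ≠ v.2) && decide (u.2 ≠ v.1) && evenIndices u.1 u.2 v.1 v.2 == ε)

/-- The set `s` is a clique of the graph `adj ε` and lies in a cell: it misses a row and a column.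
The empty set is included. -/
def IsCellClique (ε : Bool) (s : Finset (Fin 4 × Fin 4)) : Prop :=
  (∃ a, ∀ v ∈ s, v.1 ≠ a) ∧ (∃ b, ∀ v ∈ s, v.2 ≠ b) ∧ ∀ u ∈ s, ∀ v ∈ s, adj ε u v = true

instance (ε : Bool) (s : Finset (Fin 4 × Fin 4)) : Decidable (IsCellClique ε s) :=
  inferInstanceAs (Decidable (_ ∧ _))

theorem IsCellClique.mono {ε : Bool} {s t : Finset (Fin 4 × Fin 4)} (ht : IsCellClique ε t)
    (hst : s ⊆ t) : IsCellClique ε s := by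
  obtain ⟨⟨a, ha⟩, ⟨b, hb⟩, h⟩ := ht
  exact ⟨⟨a, fun v hv => ha v (hst hv)⟩, ⟨b, fun v hv => hb v (hst hv)⟩,
    fun u hu v hv => h u (hst hu) v (hst hv)⟩

theorem adj_swap : ∀ (ε : Bool) (u v : Fin 4 × Fin 4),
    adj ε u.swap v.swap = adj ε u v := by decide +kernel

theorem adj_prodMap_of_mem_alternatingGroup : ∀ σ ∈ alternatingGroup (Fin 4),
    ∀ u v : Fin 4 × Fin 4, adj true (Prod.map σ σ u) (Prod.map σ σ v) = adj true u v := by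
  simp only [Equiv.Perm.mem_alternatingGroup]
  decide +kernel

/-- An odd permutation of the indices exchanges the two graphs. -/
theorem adj_prodMap_swap : ∀ (ε : Bool) (u v : Fin 4 × Fin 4),
    adj ε (Prod.map (Equiv.swap 0 1) (Equiv.swap 0 1) u)
      (Prod.map (Equiv.swap 0 1) (Equiv.swap 0 1) v) = adj (!ε) u v := by
  decide +kernel

/-- The two diagonals of a square are not both edges. -/
theorem not_adj_square : ∀ (ε : Bool) (i k j l : Fin 4), i ≠ k → j ≠ l →
    adj ε (i, j) (k, l) = true → adj ε (i, l) (k, j) = true → False := by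
  decide +kernel

/-- The two halves of a hexagon `i₁j₁, i₁j₂, i₂j₂, i₂j₃, i₃j₃, i₃j₁`, taken alternately, are not both
triangles of the graph. -/
theorem not_adj_hexagon : ∀ (ε : Bool) (i₁ i₂ i₃ : Fin 4), i₁ ≠ i₂ → i₂ ≠ i₃ → i₁ ≠ i₃ →
    ∀ (j₁ j₂ j₃ : Fin 4), j₁ ≠ j₂ → j₂ ≠ j₃ → j₁ ≠ j₃ →
    adj ε (i₁, j₁) (i₂, j₂) = true → adj ε (i₂, j₂) (i₃, j₃) = true →
    adj ε (i₁, j₁) (i₃, j₃) = true → adj ε (i₁, j₂) (i₂, j₃) = true →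
    adj ε (i₂, j₃) (i₃, j₁) = true → adj ε (i₁, j₂) (i₃, j₁) = true → False := by
  simp only [imp_false]
  decide +kernel

/-- The cost that makes `cliqueTriangulation ε` regular on the cell in which row `a` and column `b`
are omitted. Rewarding the diagonal decides every square except the two with four distinct
indices, which exist only for `a ≠ b`; these are decided by the two entries whose indices are
different from `a` and `b`. No single cost serves all the cells. -/
def cellCost (ε : Bool) (a b i j : Fin 4) : ℤ :=
  if i = j then -3
  else if a = b ∨ i = a ∨ i = b ∨ j = a ∨ j = b then 0
  else if adj ε (b, a) (i, j) then -1 else 1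

/-- In every square of the cell, the edge is the cheaper diagonal. -/
theorem cellCost_lt : ∀ (ε : Bool) (a b i : Fin 4), i ≠ a → ∀ k, k ≠ a → ∀ j, j ≠ b → ∀ l, l ≠ b →
    adj ε (i, j) (k, l) = false →
    cellCost ε a b i l + cellCost ε a b k j < cellCost ε a b i j + cellCost ε a b k l := by
  decide +kernel

theorem not_adj_swap_self : ∀ (ε : Bool) (u : Fin 4 × Fin 4), u.swap ≠ u →
    adj ε u u.swap = false := by
  decide +kernel

/-- The combinatorial form of purity: a vertex joined to both members of a nontrivial orbit of the
flip, and different from them, is fixed by the flip. -/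
theorem isDiag_of_adj : ∀ (ε : Bool) (w u : Fin 4 × Fin 4), u.swap ≠ u → w ≠ u → w ≠ u.swap →
    adj ε w u = true → adj ε w u.swap = true → w.swap = w := by
  decide +kernel


/-! ### Enumeration of cliques -/

/-- The sublists of a list that satisfy `p`, built from the end of the list and discarding at each
step those which fail `p`. For a predicate inherited by tails these are all the sublists with `p`
(`prunedSublists_eq_filter`), found without running through the other ones. -/
def prunedSublists {α : Type*} (p : List α → Bool) : List α → List (List α)
  | [] => [[]]
  | a :: l => (fun r => r ++ (r.map (a :: ·)).filter p) (prunedSublists p l)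

theorem prunedSublists_eq_filter {α : Type*} {p : List α → Bool} (h0 : p [] = true)
    (hp : ∀ a l, p (a :: l) = true → p l = true) (l : List α) :
    prunedSublists p l = (l.sublists').filter p := by
  induction l with
  | nil => simp [prunedSublists, h0]
  | cons a l ih =>
    simp only [prunedSublists, ih, List.sublists'_cons, List.filter_append, List.filter_map,
      List.filter_filter]
    congr 2
    apply List.filter_congr
    intro x _
    have := hp a x
    by_cases h : p (a :: x) = true <;> simp_all

/-- The Boolean form of `IsCellClique` for lists. -/
def isCliqueList (ε : Bool) (l : List (Fin 4 × Fin 4)) : Bool :=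
  (List.finRange 4).any (fun a => l.all fun v => v.1 != a) &&
    (List.finRange 4).any (fun b => l.all fun v => v.2 != b) &&
    l.all fun u => l.all fun v => adj ε u v

theorem isCliqueList_iff {ε : Bool} {l : List (Fin 4 × Fin 4)} :
    isCliqueList ε l = true ↔ (∃ a, ∀ v ∈ l, v.1 ≠ a) ∧ (∃ b, ∀ v ∈ l, v.2 ≠ b) ∧
      ∀ u ∈ l, ∀ v ∈ l, adj ε u v = true := by
  simp only [isCliqueList, Bool.and_eq_true, List.any_eq_true, List.all_eq_true, bne_iff_ne,
    List.mem_finRange, true_and, and_assoc]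

theorem prunedSublists_isCliqueList (ε : Bool) (l : List (Fin 4 × Fin 4)) :
    prunedSublists (isCliqueList ε) l = (l.sublists').filter (isCliqueList ε) := by
  refine prunedSublists_eq_filter rfl (fun a m h => ?_) l
  obtain ⟨⟨i, hi⟩, ⟨j, hj⟩, h⟩ := isCliqueList_iff.1 h
  exact isCliqueList_iff.2 ⟨⟨i, fun v hv => hi v (List.mem_cons_of_mem _ hv)⟩,
    ⟨j, fun v hv => hj v (List.mem_cons_of_mem _ hv)⟩,
    fun u hu v hv => h u (List.mem_cons_of_mem _ hu) v (List.mem_cons_of_mem _ hv)⟩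

theorem IsCellClique.filter_mem_prunedSublists {ε : Bool} {s : Finset (Fin 4 × Fin 4)}
    (hs : IsCellClique ε s) (l : List (Fin 4 × Fin 4)) :
    l.filter (· ∈ s) ∈ prunedSublists (isCliqueList ε) l := by
  rw [prunedSublists_isCliqueList, List.mem_filter, List.mem_sublists', isCliqueList_iff]
  obtain ⟨⟨a, ha⟩, ⟨b, hb⟩, h⟩ := hs
  have hm : ∀ v ∈ l.filter (· ∈ s), v ∈ s := fun v hv => by
    simpa using (List.mem_filter.1 hv).2
  exact ⟨List.filter_sublist, ⟨a, fun v hv => ha v (hm v hv)⟩, ⟨b, fun v hv => hb v (hm v hv)⟩,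
    fun u hu v hv => h u (hm u hu) v (hm v hv)⟩

theorem card_filter_isCellClique (ε : Bool) (n : ℕ) :
    (Finset.univ.filter fun s : Finset (Fin 4 × Fin 4) => IsCellClique ε s ∧ s.card = n).card =
      (prunedSublists (isCliqueList ε) (List.finRange 4 ×ˢ List.finRange 4)).countP
        (fun l => l.length == n) := by
  classical
  let Q : Multiset (Fin 4 × Fin 4) → Prop := fun m =>
    ((∃ a, ∀ v ∈ m, v.1 ≠ a) ∧ (∃ b, ∀ v ∈ m, v.2 ≠ b) ∧
      ∀ u ∈ m, ∀ v ∈ m, adj ε u v = true) ∧ m.card = n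
  have huniv : (Finset.univ : Finset (Fin 4 × Fin 4)).val =
      ((List.finRange 4 ×ˢ List.finRange 4 : List (Fin 4 × Fin 4)) : Multiset (Fin 4 × Fin 4)) := by
    decide +kernel
  -- As multisets, the subsets of the vertex set are the sublists of the list of vertices.
  have hmap : (Finset.univ : Finset (Finset (Fin 4 × Fin 4))).val.map Finset.val =
      ((List.finRange 4 ×ˢ List.finRange 4 : List (Fin 4 × Fin 4)).sublists'.map
        (↑) : List (Multiset (Fin 4 × Fin 4))) := by
    rw [← Finset.powerset_univ, Finset.powerset, Multiset.map_pmap, ← Multiset.powerset_coe',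
      ← huniv]
    simp [Multiset.pmap_eq_map]
  have hcount : (Finset.univ.filter fun s : Finset (Fin 4 × Fin 4) =>
      IsCellClique ε s ∧ s.card = n).card =
      ((Finset.univ : Finset (Finset (Fin 4 × Fin 4))).val.map Finset.val).countP Q := by
    rw [Multiset.countP_map]
    rfl
  rw [hcount, hmap, prunedSublists_isCliqueList, Multiset.coe_countP, List.countP_map,
    List.countP_filter]
  apply List.countP_congr
  intro l _
  simp only [Function.comp_apply, Q, decide_eq_true_eq, Multiset.mem_coe, Multiset.coe_card,
    Bool.and_eq_true, isCliqueList_iff, beq_iff_eq]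
  exact and_comm

/-! ### The faces of the 16-vertex complex -/

theorem isCellClique_of_mem_basicFacets : ∀ b ∈ basicFacets, IsCellClique true b := by
  simp only [basicFacets, Finset.forall_mem_insert, Finset.mem_singleton, forall_eq]
  decide +kernel

theorem IsCellClique.image_prodMap {s : Finset (Fin 4 × Fin 4)} (hs : IsCellClique true s)
    {σ : Equiv.Perm (Fin 4)} (hσ : σ ∈ alternatingGroup (Fin 4)) :
    IsCellClique true (s.image (Prod.map σ σ)) := by
  obtain ⟨⟨a, ha⟩, ⟨b, hb⟩, h⟩ := hs
  simp only [IsCellClique, Finset.forall_mem_image, Prod.map_fst, Prod.map_snd]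
  refine ⟨⟨σ a, fun v hv => ?_⟩, ⟨σ b, fun v hv => ?_⟩, fun u hu v hv => ?_⟩
  · simpa using ha v hv
  · simpa using hb v hv
  · rw [adj_prodMap_of_mem_alternatingGroup σ hσ]
    exact h u hu v hv

theorem IsCellClique.image_swap {ε : Bool} {s : Finset (Fin 4 × Fin 4)} (hs : IsCellClique ε s) :
    IsCellClique ε (s.image Prod.swap) := by
  obtain ⟨⟨a, ha⟩, ⟨b, hb⟩, h⟩ := hs
  simp only [IsCellClique, Finset.forall_mem_image, Prod.fst_swap, Prod.snd_swap, adj_swap]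
  exact ⟨⟨b, hb⟩, ⟨a, ha⟩, fun u hu v hv => h u hu v hv⟩

/-- A parametrization, for `y ≠ 0`, of the twelve even permutations of the indices. -/
def evenPerm (x y : Fin 4) : Equiv.Perm (Fin 4) :=
  if x = 0 ↔ y = 1 then Equiv.swap 0 x * Equiv.swap 1 y
  else Equiv.swap 0 x * Equiv.swap 1 y * Equiv.swap 2 3

theorem evenPerm_mem_alternatingGroup :
    ∀ x y : Fin 4, y ≠ 0 → evenPerm x y ∈ alternatingGroup (Fin 4) := by
  simp only [Equiv.Perm.mem_alternatingGroup]
  decide +kernel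

theorem exists_evenPerm_mapsTo : ∀ a b : Fin 4, ∃ x y : Fin 4, y ≠ 0 ∧
    evenPerm x y a = 3 ∧ (evenPerm x y b = 3 ∨ evenPerm x y b = 2) := by
  decide +kernel
/-- Up to even permutations of the indices there are two kinds of `3 × 3` cells, and in each of them
every clique is contained in a facet. -/
theorem exists_basicFacet_of_mem_prunedSublists {c : Fin 4} (hc : c = 3 ∨ c = 2) :
    ∀ l ∈ prunedSublists (isCliqueList true)
      ([0, 1, 2] ×ˢ ((List.finRange 4).filter (· ≠ c)) : List (Fin 4 × Fin 4)),
    ∃ x y : Fin 4, y ≠ 0 ∧ ∃ b ∈ basicFacets,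
      (∀ v ∈ l, Prod.map (evenPerm x y) (evenPerm x y) v ∈ b) ∨
      (∀ v ∈ l, Prod.map (evenPerm x y) (evenPerm x y) v.swap ∈ b) := by
  rcases hc with rfl | rfl <;> decide +kernel

theorem mem_s2s2Facets_image {t : Finset (Fin 4 × Fin 4)} (ht : t ∈ s2s2Facets)
    {σ : Equiv.Perm (Fin 4)} (hσ : σ ∈ alternatingGroup (Fin 4)) :
    t.image (Prod.map σ σ) ∈ s2s2Facets := by
  obtain ⟨τ, hτ, b, hb, rfl | rfl⟩ := ht
  · refine ⟨σ * τ, mul_mem hσ hτ, b, hb, Or.inl ?_⟩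
    rw [Finset.image_image]; rfl
  · refine ⟨σ * τ, mul_mem hσ hτ, b, hb, Or.inr ?_⟩
    simp only [Finset.image_image]; rfl

theorem subset_image_prodMap_inv {s t : Finset (Fin 4 × Fin 4)} {σ : Equiv.Perm (Fin 4)}
    (h : ∀ v ∈ s, Prod.map σ σ v ∈ t) : s ⊆ t.image (Prod.map ⇑σ⁻¹ ⇑σ⁻¹) := by
  intro v hv
  exact Finset.mem_image.2 ⟨_, h v hv, Prod.ext (σ.symm_apply_apply _) (σ.symm_apply_apply _)⟩

theorem IsCellClique.exists_subset_facet {s : Finset (Fin 4 × Fin 4)}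
    (hs : IsCellClique true s) : ∃ t ∈ s2s2Facets, s ⊆ t := by
  obtain ⟨⟨a, ha⟩, ⟨b, hb⟩, h⟩ := id hs
  obtain ⟨x, y, hy, h3, h32⟩ := exists_evenPerm_mapsTo a b
  set σ := evenPerm x y with hσ
  have hσA : σ ∈ alternatingGroup (Fin 4) := evenPerm_mem_alternatingGroup x y hy
  set c := σ b with hc
  obtain ⟨x', y', hy', f, hf, h⟩ := exists_basicFacet_of_mem_prunedSublists h32 _
    ((hs.image_prodMap hσA).filter_mem_prunedSublists _)
  set τ := evenPerm x' y'
  have hτA : τ ∈ alternatingGroup (Fin 4) := evenPerm_mem_alternatingGroup x' y' hy'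
  have hmem : ∀ v ∈ s.image (Prod.map σ σ), v ∈
      ([0, 1, 2] ×ˢ ((List.finRange 4).filter (· ≠ c)) : List (Fin 4 × Fin 4)).filter
        (· ∈ s.image (Prod.map σ σ)) := by
    intro v hv
    simp only [List.mem_filter, hv, decide_true, and_true]
    obtain ⟨w, hw, rfl⟩ := Finset.mem_image.1 hv
    have h1 : σ w.1 ≠ 3 := by
      rw [← h3]; simpa using ha w hw
    have h2 : σ w.2 ≠ c := by simpa [hc] using hb w hw
    have h1' : ∀ i : Fin 4, i ≠ 3 → i ∈ [0, 1, 2] := by decide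
    exact List.mem_product.2 ⟨h1' _ h1, List.mem_filter.2 ⟨List.mem_finRange _, by simpa using h2⟩⟩
  have hcover : ∃ t ∈ s2s2Facets, s.image (Prod.map σ σ) ⊆ t := by
    rcases h with h | h
    · exact ⟨_, ⟨τ⁻¹, inv_mem hτA, f, hf, Or.inl rfl⟩,
        subset_image_prodMap_inv fun v hv => h v (hmem v hv)⟩
    · refine ⟨_, ⟨τ⁻¹, inv_mem hτA, f, hf, Or.inr rfl⟩, fun v hv => ?_⟩
      exact Finset.mem_image.2 ⟨v.swap, Finset.mem_image.2 ⟨_, h v (hmem v hv),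
        Prod.ext (τ.symm_apply_apply _) (τ.symm_apply_apply _)⟩, v.swap_swap⟩
  obtain ⟨t, ht, hst⟩ := hcover
  refine ⟨_, mem_s2s2Facets_image ht (inv_mem hσA), subset_image_prodMap_inv fun v hv => ?_⟩
  exact hst (Finset.mem_image_of_mem _ hv)

theorem mem_s2s2_faces_iff {s : Finset (Fin 4 × Fin 4)} :
    s ∈ s2s2.faces ↔ s.Nonempty ∧ IsCellClique true s := by
  refine and_congr_right fun _ => ⟨?_, IsCellClique.exists_subset_facet⟩
  rintro ⟨t, ⟨σ, hσ, b, hb, rfl | rfl⟩, hst⟩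
  · exact ((isCellClique_of_mem_basicFacets b hb).image_prodMap hσ).mono hst
  · exact ((isCellClique_of_mem_basicFacets b hb).image_prodMap hσ).image_swap.mono hst

theorem map_countP_prunedSublists :
    [1, 2, 3, 4, 5].map (fun n =>
      (prunedSublists (isCliqueList true) (List.finRange 4 ×ˢ List.finRange 4)).countP
        (fun l => l.length == n)) = [16, 84, 216, 240, 96] := by
  decide +kernel

theorem card_filter_isCellClique_eq (i : Fin 5) :
    (Finset.univ.filter fun s : Finset (Fin 4 × Fin 4) =>
      IsCellClique true s ∧ s.card = (i : ℕ) + 1).card = ![16, 84, 216, 240, 96] i := by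
  have h := map_countP_prunedSublists
  simp only [← card_filter_isCellClique, List.map_cons, List.map_nil, List.cons.injEq,
    and_true] at h
  obtain ⟨h1, h2, h3, h4, h5⟩ := h
  fin_cases i
  exacts [h1, h2, h3, h4, h5]

theorem hasFaceVector_s2s2 : HasFaceVector s2s2 ![16, 84, 216, 240, 96] := by
  have hcard : ∀ b ∈ basicFacets, b.card = 5 := by
    simp only [basicFacets, Finset.forall_mem_insert, Finset.mem_singleton, forall_eq]
    decide +kernel
  refine ⟨?_, ?_, fun i => ?_⟩
  · rintro s ⟨-, t, ⟨σ, hσ, b, hb, rfl | rfl⟩, hst⟩ <;>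
      refine (Finset.card_le_card hst).trans ?_
    · exact Finset.card_image_le.trans (hcard b hb).le
    · exact Finset.card_image_le.trans (Finset.card_image_le.trans (hcard b hb).le)
  · obtain ⟨b, hb⟩ : basicFacets.Nonempty := ⟨_, Finset.mem_insert_self _ _⟩
    refine ⟨b, mem_s2s2_faces_iff.2 ⟨?_, isCellClique_of_mem_basicFacets b hb⟩, hcard b hb⟩
    exact Finset.card_pos.1 (by rw [hcard b hb]; norm_num)
  · have hset : {s ∈ s2s2.faces | s.card = (i : ℕ) + 1} =
        ((Finset.univ.filter fun s : Finset (Fin 4 × Fin 4) =>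
          IsCellClique true s ∧ s.card = (i : ℕ) + 1 : Finset _) : Set _) := by
      ext s
      simp only [Set.mem_ofPred_eq, mem_s2s2_faces_iff, Finset.coe_filter, Finset.mem_univ, true_and]
      refine ⟨fun h => ⟨h.1.2, h.2⟩, fun h => ⟨⟨?_, h.1⟩, h.2⟩⟩
      exact Finset.card_pos.1 (by omega)
    rw [hset, Set.encard_coe_eq_coe_finsetCard, card_filter_isCellClique_eq]

/-! ### Circuits and transport plans -/

/-- A matrix with zero marginals and a zero column vanishes if its positive and its negative entries
both form cliques: otherwise a path alternating between positive and negative entries, moving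
along rows and columns in turn, closes up to a square or a hexagon. -/
theorem eq_zero_of_adj_of_sum_eq_zero {ε : Bool} {z : Fin 4 × Fin 4 → ℝ} {b : Fin 4}
    (hrow : ∀ i, ∑ j, z (i, j) = 0) (hcol : ∀ j, ∑ i, z (i, j) = 0) (hb : ∀ i, z (i, b) = 0)
    (hpos : ∀ u v, 0 < z u → 0 < z v → adj ε u v = true)
    (hneg : ∀ u v, z u < 0 → z v < 0 → adj ε u v = true) : z = 0 := by
  have key : ∀ f : Fin 4 → ℝ, ∑ j, f j = 0 → ∀ j, f j ≠ 0 → (∃ k, 0 < f k) ∧ ∃ k, f k < 0 := by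
    intro f hf j hj
    obtain ⟨k, -, hk⟩ := Finset.exists_pos_of_sum_zero_of_exists_nonzero f hf ⟨j, by simp, hj⟩
    obtain ⟨k', -, hk'⟩ := Finset.exists_pos_of_sum_zero_of_exists_nonzero (fun j => -f j)
      (by rw [Finset.sum_neg_distrib, hf, neg_zero] : ∑ j, -f j = 0) ⟨j, by simp, by simpa using hj⟩
    exact ⟨⟨k, hk⟩, ⟨k', by linarith⟩⟩
  have hne : ∀ i j, z (i, j) ≠ 0 → j ≠ b := by
    rintro i j h rfl
    exact h (hb i)
  by_contra hz
  obtain ⟨⟨i, j⟩, hij⟩ := Function.ne_iff.1 hz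
  obtain ⟨⟨j₁, h11⟩, -⟩ := key (fun j => z (i, j)) (hrow i) j hij
  obtain ⟨-, ⟨j₂, h12⟩⟩ := key (fun j => z (i, j)) (hrow i) j hij
  obtain ⟨⟨i₂, h22⟩, -⟩ := key (fun i => z (i, j₂)) (hcol j₂) i h12.ne
  obtain ⟨-, ⟨j₃, h23⟩⟩ := key (fun j => z (i₂, j)) (hrow i₂) j₂ h22.ne'
  obtain ⟨⟨i₃, h33⟩, -⟩ := key (fun i => z (i, j₃)) (hcol j₃) i₂ h23.ne
  obtain ⟨-, ⟨j₄, h34⟩⟩ := key (fun j => z (i₃, j)) (hrow i₃) j₃ h33.ne'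
  have n1 : i ≠ i₂ := by rintro rfl; linarith
  have n2 : i₂ ≠ i₃ := by rintro rfl; linarith
  have m1 : j₁ ≠ j₂ := by rintro rfl; linarith
  have m2 : j₂ ≠ j₃ := by rintro rfl; linarith
  have m3 : j₃ ≠ j₄ := by rintro rfl; linarith
  by_cases m4 : j₁ = j₃
  · subst m4
    exact not_adj_square ε i i₂ j₁ j₂ n1 m1 (hpos _ _ h11 h22) (hneg _ _ h12 h23)
  by_cases n3 : i = i₃
  · subst n3
    exact not_adj_square ε i i₂ j₃ j₂ n1 m2.symm (hpos _ _ h33 h22) (hneg _ _ h12 h23)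
  by_cases m5 : j₂ = j₄
  · subst m5
    exact not_adj_square ε i₂ i₃ j₂ j₃ n2 m2 (hpos _ _ h22 h33) (hneg _ _ h23 h34)
  -- Only three columns are available, so the alternating path closes up to a hexagon.
  have m6 : j₄ = j₁ := by
    have := hne _ _ h11.ne'
    have := hne _ _ h22.ne'
    have := hne _ _ h33.ne'
    have := hne _ _ h34.ne
    omega
  subst m6
  exact not_adj_hexagon ε i i₂ i₃ n1 n2 n3 j₄ j₂ j₃ m1 m2 m4 (hpos _ _ h11 h22)
    (hpos _ _ h22 h33) (hpos _ _ h11 h33) (hneg _ _ h12 h23) (hneg _ _ h23 h34)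
    (hneg _ _ h12 h34)

/-- The `4 × 4` matrix `w` is nonnegative and its row and column sums are the components of `p`. When
`p` is a point of the product of two standard simplices, these are the ways to write `p` as a convex
combination of the product vertices. -/
structure IsTransportPlan (w : Fin 4 × Fin 4 → ℝ) (p : (Fin 4 → ℝ) × (Fin 4 → ℝ)) : Prop where
  nonneg : ∀ v, 0 ≤ w v
  row : ∀ i, ∑ j, w (i, j) = p.1 i
  col : ∀ j, ∑ i, w (i, j) = p.2 j

theorem IsTransportPlan.eq_zero_of_fst {w : Fin 4 × Fin 4 → ℝ} {p : (Fin 4 → ℝ) × (Fin 4 → ℝ)}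
    (h : IsTransportPlan w p) {i : Fin 4} (hi : p.1 i = 0) (j : Fin 4) : w (i, j) = 0 :=
  (Finset.sum_eq_zero_iff_of_nonneg fun j _ => h.nonneg (i, j)).1 ((h.row i).trans hi) j
    (Finset.mem_univ j)

theorem IsTransportPlan.eq_zero_of_snd {w : Fin 4 × Fin 4 → ℝ} {p : (Fin 4 → ℝ) × (Fin 4 → ℝ)}
    (h : IsTransportPlan w p) {j : Fin 4} (hj : p.2 j = 0) (i : Fin 4) : w (i, j) = 0 :=
  (Finset.sum_eq_zero_iff_of_nonneg fun i _ => h.nonneg (i, j)).1 ((h.col j).trans hj) i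
    (Finset.mem_univ i)

theorem IsTransportPlan.eq_of_isCellClique {ε : Bool} {w w' : Fin 4 × Fin 4 → ℝ}
    {p : (Fin 4 → ℝ) × (Fin 4 → ℝ)} {s t : Finset (Fin 4 × Fin 4)} (h : IsTransportPlan w p)
    (h' : IsTransportPlan w' p) (hs : IsCellClique ε s) (ht : IsCellClique ε t)
    (hws : ∀ v ∉ s, w v = 0) (hwt : ∀ v ∉ t, w' v = 0) : w = w' := by
  obtain ⟨-, ⟨b, hb⟩, hs⟩ := hs
  obtain ⟨-, -, ht⟩ := ht
  have hpb : p.2 b = 0 := by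
    rw [← h.col b]
    exact Finset.sum_eq_zero fun i _ => hws _ fun hi => hb _ hi rfl
  refine sub_eq_zero.1 (eq_zero_of_adj_of_sum_eq_zero (ε := ε) (z := w - w') (b := b)
    (fun i => ?_) (fun j => ?_) (fun i => ?_) (fun u v hu hv => ?_) fun u v hu hv => ?_)
  · simp [Finset.sum_sub_distrib, h.row, h'.row]
  · simp [Finset.sum_sub_distrib, h.col, h'.col]
  · simp [h.eq_zero_of_snd hpb, h'.eq_zero_of_snd hpb]
  · have hmem : ∀ v, 0 < (w - w') v → v ∈ s := by
      intro v hv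
      by_contra hn
      have := h'.nonneg v
      simp only [Pi.sub_apply, hws v hn] at hv
      linarith
    exact hs u (hmem u hu) v (hmem v hv)
  · have hmem : ∀ v, (w - w') v < 0 → v ∈ t := by
      intro v hv
      by_contra hn
      have := h.nonneg v
      simp only [Pi.sub_apply, hwt v hn] at hv
      linarith
    exact ht u (hmem u hu) v (hmem v hv)

/-- Mass `δ` may be moved from one diagonal of a square to the other one. -/
theorem IsTransportPlan.exchange {w : Fin 4 × Fin 4 → ℝ} {p : (Fin 4 → ℝ) × (Fin 4 → ℝ)}
    (h : IsTransportPlan w p) {i k j l : Fin 4} (hjl : j ≠ l) {δ : ℝ} (hδ : 0 ≤ δ)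
    (hij : δ ≤ w (i, j)) (hkl : δ ≤ w (k, l)) :
    IsTransportPlan (fun v => w v + δ * ((Pi.single i 1 - Pi.single k 1 : Fin 4 → ℝ) v.1 *
      (Pi.single l 1 - Pi.single j 1 : Fin 4 → ℝ) v.2)) p where
  nonneg := by
    rintro ⟨x, y⟩
    have := h.nonneg (x, y)
    simp only [Pi.sub_apply, Pi.single_apply]
    split_ifs <;> simp_all <;> linarith
  row x := by
    simp only [Finset.sum_add_distrib, h.row, ← Finset.mul_sum]
    simp [Finset.sum_sub_distrib]
  col y := by
    simp only [Finset.sum_add_distrib, h.col, ← Finset.mul_sum, ← Finset.sum_mul]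
    simp [Finset.sum_sub_distrib]

theorem isTransportPlan_mul {p : (Fin 4 → ℝ) × (Fin 4 → ℝ)} (h1 : p.1 ∈ stdSimplex ℝ (Fin 4))
    (h2 : p.2 ∈ stdSimplex ℝ (Fin 4)) : IsTransportPlan (fun v => p.1 v.1 * p.2 v.2) p where
  nonneg v := mul_nonneg (h1.1 _) (h2.1 _)
  row i := by dsimp only; rw [← Finset.mul_sum, h2.2, mul_one]
  col j := by dsimp only; rw [← Finset.sum_mul, h1.2, one_mul]

theorem isCompact_isTransportPlan (p : (Fin 4 → ℝ) × (Fin 4 → ℝ)) :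
    IsCompact {w | IsTransportPlan w p} := by
  have hset : {w | IsTransportPlan w p} = {w : Fin 4 × Fin 4 → ℝ | (∀ v, 0 ≤ w v) ∧
      (∀ i, ∑ j, w (i, j) = p.1 i) ∧ ∀ j, ∑ i, w (i, j) = p.2 j} := by
    ext w
    exact ⟨fun h => ⟨h.1, h.2, h.3⟩, fun h => ⟨h.1, h.2.1, h.2.2⟩⟩
  refine (isCompact_univ_pi fun v : Fin 4 × Fin 4 =>
    isCompact_Icc (a := (0 : ℝ)) (b := p.1 v.1)).of_isClosed_subset ?_ ?_
  · rw [hset]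
    simp only [Set.ofPred_and, Set.ofPred_forall]
    refine (isClosed_iInter fun v => isClosed_le (by fun_prop) (by fun_prop)).inter
      ((isClosed_iInter fun i => isClosed_eq (by fun_prop) (by fun_prop)).inter
        (isClosed_iInter fun j => isClosed_eq (by fun_prop) (by fun_prop)))
  · intro w hw v _
    refine ⟨hw.nonneg v, ?_⟩
    rw [← hw.row v.1]
    exact Finset.single_le_sum (f := fun j => w (v.1, j)) (fun j _ => hw.nonneg (v.1, j))
      (Finset.mem_univ v.2)

/-- The support of a plan of least cost is a clique. -/
theorem exists_isTransportPlan_isCellClique (ε : Bool) {p : (Fin 4 → ℝ) × (Fin 4 → ℝ)}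
    (h1 : p.1 ∈ stdSimplex ℝ (Fin 4)) (h2 : p.2 ∈ stdSimplex ℝ (Fin 4)) {a b : Fin 4}
    (ha : p.1 a = 0) (hb : p.2 b = 0) :
    ∃ w s, IsTransportPlan w p ∧ IsCellClique ε s ∧ ∀ v ∉ s, w v = 0 := by
  obtain ⟨w, hw, hmin⟩ := (isCompact_isTransportPlan p).exists_isMinOn
    ⟨_, isTransportPlan_mul h1 h2⟩
    (f := fun w => ∑ v : Fin 4 × Fin 4, (cellCost ε a b v.1 v.2 : ℝ) * w v) (by fun_prop)
  have hane : ∀ v : Fin 4 × Fin 4, w v ≠ 0 → v.1 ≠ a := by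
    rintro ⟨i, j⟩ hv rfl
    exact hv (IsTransportPlan.eq_zero_of_fst hw ha j)
  have hbne : ∀ v : Fin 4 × Fin 4, w v ≠ 0 → v.2 ≠ b := by
    rintro ⟨i, j⟩ hv rfl
    exact hv (IsTransportPlan.eq_zero_of_snd hw hb i)
  refine ⟨w, Finset.univ.filter (w · ≠ 0), hw, ⟨⟨a, ?_⟩, ⟨b, ?_⟩, ?_⟩, by simp⟩
  · simpa using fun i j => hane (i, j)
  · simpa using fun i j => hbne (i, j)
  rintro ⟨i, j⟩ hu ⟨k, l⟩ hv
  simp only [Finset.mem_filter, Finset.mem_univ, true_and] at hu hv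
  by_contra hadj
  have hik : i ≠ k := by rintro rfl; simp [adj] at hadj
  have hjl : j ≠ l := by rintro rfl; simp [adj] at hadj
  have hlt := cellCost_lt ε a b i (hane _ hu) k (hane _ hv) j (hbne _ hu) l (hbne _ hv)
    (by simpa using hadj)
  have hlt' : (cellCost ε a b i l : ℝ) + cellCost ε a b k j <
      cellCost ε a b i j + cellCost ε a b k l := by exact_mod_cast hlt
  have hpos : 0 < min (w (i, j)) (w (k, l)) :=
    lt_min ((hw.nonneg _).lt_of_ne' hu) ((hw.nonneg _).lt_of_ne' hv)
  -- Moving mass off the non-edge `{(i, j), (k, l)}` would lower the cost.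
  have hle := hmin (IsTransportPlan.exchange hw hjl hpos.le (min_le_left _ _)
    (min_le_right _ _))
  simp only [Set.mem_ofPred_eq] at hle
  generalize min (w (i, j)) (w (k, l)) = δ at hpos hle
  have hsum : ∑ v : Fin 4 × Fin 4, (cellCost ε a b v.1 v.2 : ℝ) *
      ((Pi.single i 1 - Pi.single k 1 : Fin 4 → ℝ) v.1 *
        (Pi.single l 1 - Pi.single j 1 : Fin 4 → ℝ) v.2) =
      cellCost ε a b i l + cellCost ε a b k j - cellCost ε a b i j - cellCost ε a b k l := by
    simp only [Fintype.sum_prod_type, Pi.sub_apply, Pi.single_apply, sub_mul, mul_sub,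
      Finset.sum_sub_distrib]
    simp
    ring
  simp only [mul_add, Finset.sum_add_distrib, mul_left_comm _ δ, ← Finset.mul_sum, hsum] at hle
  nlinarith

/-! ### Convex hulls of product vertices -/

theorem productVertex_injective : Function.Injective productVertex := by
  rintro ⟨i, j⟩ ⟨k, l⟩ h
  simp only [productVertex, Prod.mk.injEq] at h
  have h1 := congr_fun h.1 i
  have h2 := congr_fun h.2 j
  simp only [Pi.single_apply] at h1 h2
  ext1 <;> simp_all

theorem sum_smul_productVertex (w : Fin 4 × Fin 4 → ℝ) :
    ∑ v, w v • productVertex v = (fun i => ∑ j, w (i, j), fun j => ∑ i, w (i, j)) := by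
  ext x
  · rw [Fintype.sum_prod_type_right]
    simp [productVertex, Prod.fst_sum, Pi.single_apply]
  · simp [productVertex, Prod.snd_sum, Fintype.sum_prod_type, Pi.single_apply]

theorem IsTransportPlan.sum_smul {w : Fin 4 × Fin 4 → ℝ} {p : (Fin 4 → ℝ) × (Fin 4 → ℝ)}
    (h : IsTransportPlan w p) : ∑ v, w v • productVertex v = p := by
  rw [sum_smul_productVertex]
  exact Prod.ext (funext h.row) (funext h.col)

theorem mem_convexHull_image_productVertex {s : Finset (Fin 4 × Fin 4)}
    {p : (Fin 4 → ℝ) × (Fin 4 → ℝ)} :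
    p ∈ convexHull ℝ ((s.image productVertex : Finset _) : Set ((Fin 4 → ℝ) × (Fin 4 → ℝ))) ↔
      ∃ w, IsTransportPlan w p ∧ ∑ v, w v = 1 ∧ ∀ v ∉ s, w v = 0 := by
  classical
  constructor
  · intro h
    obtain ⟨w, hw0, hw1, hwp⟩ := Finset.mem_convexHull'.1 h
    rw [Finset.sum_image productVertex_injective.injOn] at hw1 hwp
    have hp : ∑ v, (if v ∈ s then w (productVertex v) else 0) • productVertex v = p := by
      simpa [ite_smul] using hwp
    rw [sum_smul_productVertex] at hp
    refine ⟨fun v => if v ∈ s then w (productVertex v) else 0, ⟨fun v => ?_, fun i => ?_,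
      fun j => ?_⟩, by simpa using hw1, fun v hv => if_neg hv⟩
    · split_ifs with hv
      exacts [hw0 _ (Finset.mem_image_of_mem _ hv), le_rfl]
    · rw [← hp]
    · rw [← hp]
  · rintro ⟨w, hw, hw1, hws⟩
    rw [← hw.sum_smul, ← Finset.sum_subset (Finset.subset_univ s) fun v _ hv => by
      rw [hws v hv, zero_smul]]
    refine (convex_convexHull ℝ _).sum_mem (fun v _ => hw.nonneg v) ?_ fun v hv =>
      subset_convexHull ℝ _ (Finset.mem_coe.2 (Finset.mem_image_of_mem _ hv))
    rw [← hw1]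
    exact Finset.sum_subset (Finset.subset_univ s) fun v _ hv => hws v hv

/-! ### The two triangulations -/

theorem mem_sUnion_productCells {p : (Fin 4 → ℝ) × (Fin 4 → ℝ)} :
    p ∈ ⋃₀ productCells ↔ (p.1 ∈ stdSimplex ℝ (Fin 4) ∧ ∃ a, p.1 a = 0) ∧
      p.2 ∈ stdSimplex ℝ (Fin 4) ∧ ∃ b, p.2 b = 0 := by
  constructor
  · rintro ⟨c, ⟨A, B, -, hA, -, hB, rfl⟩, h1, h2⟩
    obtain ⟨a, ha⟩ := not_forall.1 (mt Finset.eq_univ_iff_forall.2 hA)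
    obtain ⟨b, hb⟩ := not_forall.1 (mt Finset.eq_univ_iff_forall.2 hB)
    exact ⟨⟨h1.1, a, h1.2 a ha⟩, h2.1, b, h2.2 b hb⟩
  · rintro ⟨⟨h1, a, ha⟩, h2, b, hb⟩
    have hne : ∀ a : Fin 4, ({a}ᶜ : Finset (Fin 4)).Nonempty ∧
        ({a}ᶜ : Finset (Fin 4)) ≠ Finset.univ := by decide
    refine ⟨_, ⟨{a}ᶜ, {b}ᶜ, (hne a).1, (hne a).2, (hne b).1, (hne b).2, rfl⟩, ⟨h1, ?_⟩, h2, ?_⟩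
    · simpa using ha
    · simpa using hb

theorem IsTransportPlan.mem_stdSimplex {w : Fin 4 × Fin 4 → ℝ} {p : (Fin 4 → ℝ) × (Fin 4 → ℝ)}
    (h : IsTransportPlan w p) (h1 : ∑ v, w v = 1) :
    p.1 ∈ stdSimplex ℝ (Fin 4) ∧ p.2 ∈ stdSimplex ℝ (Fin 4) := by
  refine ⟨⟨fun i => ?_, ?_⟩, fun j => ?_, ?_⟩
  · rw [← h.row]; exact Finset.sum_nonneg fun j _ => h.nonneg _
  · simp only [← h.row, ← h1, Fintype.sum_prod_type]
  · rw [← h.col]; exact Finset.sum_nonneg fun j _ => h.nonneg _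
  · simp only [← h.col, ← h1, Fintype.sum_prod_type_right]

theorem IsTransportPlan.sum_eq_one {w : Fin 4 × Fin 4 → ℝ} {p : (Fin 4 → ℝ) × (Fin 4 → ℝ)}
    (h : IsTransportPlan w p) (h1 : p.1 ∈ stdSimplex ℝ (Fin 4)) : ∑ v, w v = 1 := by
  rw [Fintype.sum_prod_type, ← h1.2]
  exact Finset.sum_congr rfl fun i _ => h.row i

/-- The abstract complex of the nonempty cliques of `adj ε` that lie in a cell. -/
def cliqueComplex (ε : Bool) : PreAbstractSimplicialComplex (Fin 4 × Fin 4) where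
  faces := {s | s.Nonempty ∧ IsCellClique ε s}
  isRelLowerSet_faces := fun _ hs => ⟨hs.1, fun _ ht hne => ⟨hne, hs.2.mono ht⟩⟩

theorem cliqueComplex_true : cliqueComplex true = s2s2 := by
  ext s
  exact mem_s2s2_faces_iff.symm

theorem IsCellClique.affineIndependent {ε : Bool} {s : Finset (Fin 4 × Fin 4)}
    (hs : IsCellClique ε s) : AffineIndependent ℝ
      ((↑) : ↥(s.image productVertex) → (Fin 4 → ℝ) × (Fin 4 → ℝ)) := by
  obtain ⟨-, ⟨b, hb⟩, hadj⟩ := hs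
  have hind : AffineIndependent ℝ (fun v : s => productVertex v) := by
    rw [affineIndependent_iff_of_fintype]
    intro w hw0 hw
    rw [Finset.univ.weightedVSub_eq_linear_combination hw0] at hw
    set z : Fin 4 × Fin 4 → ℝ := fun v => if h : v ∈ s then w ⟨v, h⟩ else 0 with hz
    have hzs : ∀ v, z v ≠ 0 → v ∈ s := fun v hv => by
      by_contra h
      exact hv (dif_neg h)
    have hsum : ∑ v, z v • productVertex v = 0 := by
      rw [← hw, ← Finset.sum_subset (Finset.subset_univ s) fun v _ hv => by
        rw [hz]; simp [hv], ← Finset.sum_coe_sort]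
      exact Finset.sum_congr rfl fun v _ => by simp [hz]
    rw [sum_smul_productVertex, Prod.ext_iff] at hsum
    have h0 := eq_zero_of_adj_of_sum_eq_zero (ε := ε) (z := z) (b := b)
      (fun i => congr_fun hsum.1 i) (fun j => congr_fun hsum.2 j)
      (fun i => dif_neg fun h => hb _ h rfl)
      (fun u v hu hv => hadj u (hzs u hu.ne') v (hzs v hv.ne'))
      (fun u v hu hv => hadj u (hzs u hu.ne) v (hzs v hv.ne))
    intro v
    have := congr_fun h0 v
    simpa [hz] using this
  have hsub : ((s.image productVertex : Finset _) : Set ((Fin 4 → ℝ) × (Fin 4 → ℝ))) ⊆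
      Set.range fun v : s => productVertex v := fun x hx => by simpa using hx
  have h := hind.range.mono hsub
  exact h

/-- The geometric realization of `cliqueComplex ε` on the product vertices. -/
noncomputable def cliqueTriangulation (ε : Bool) :
    Geometry.SimplicialComplex ℝ ((Fin 4 → ℝ) × (Fin 4 → ℝ)) where
  toPreAbstractSimplicialComplex := (cliqueComplex ε).map productVertex
  indep := by
    rintro _ ⟨s, hs, rfl⟩
    exact hs.2.affineIndependent
  inter_subset_convexHull := by
    rintro _ _ ⟨s, hs, rfl⟩ ⟨t, ht, rfl⟩ p ⟨hps, hpt⟩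
    obtain ⟨w, hw, hw1, hws⟩ := mem_convexHull_image_productVertex.1 hps
    obtain ⟨w', hw', -, hwt⟩ := mem_convexHull_image_productVertex.1 hpt
    obtain rfl := hw.eq_of_isCellClique hw' hs.2 ht.2 hws hwt
    rw [← Finset.coe_inter, ← Finset.image_inter _ _ productVertex_injective]
    refine mem_convexHull_image_productVertex.2 ⟨w, hw, hw1, fun v hv => ?_⟩
    rw [Finset.mem_inter, not_and_or] at hv
    exact hv.elim (hws v) (hwt v)

theorem image_mem_cliqueTriangulation_faces {ε : Bool} {s : Finset (Fin 4 × Fin 4)} :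
    s.image productVertex ∈ (cliqueTriangulation ε).faces ↔ s.Nonempty ∧ IsCellClique ε s := by
  constructor
  · rintro ⟨t, ht, hts⟩
    rwa [← Finset.image_injective productVertex_injective hts]
  · exact fun h => ⟨s, h, rfl⟩

theorem cliqueTriangulation_space (ε : Bool) :
    (cliqueTriangulation ε).space = ⋃₀ productCells := by
  ext p
  rw [Geometry.SimplicialComplex.mem_space_iff, mem_sUnion_productCells]
  constructor
  · rintro ⟨_, ⟨s, ⟨-, ⟨a, ha⟩, ⟨b, hb⟩, -⟩, rfl⟩, hp⟩
    obtain ⟨w, hw, hw1, hws⟩ := mem_convexHull_image_productVertex.1 hp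
    obtain ⟨h1, h2⟩ := hw.mem_stdSimplex hw1
    refine ⟨⟨h1, a, ?_⟩, h2, b, ?_⟩
    · rw [← hw.row]
      exact Finset.sum_eq_zero fun j _ => hws _ fun h => ha _ h rfl
    · rw [← hw.col]
      exact Finset.sum_eq_zero fun i _ => hws _ fun h => hb _ h rfl
  · rintro ⟨⟨h1, a, ha⟩, h2, b, hb⟩
    obtain ⟨w, s, hw, hs, hws⟩ := exists_isTransportPlan_isCellClique ε h1 h2 ha hb
    have hw1 := hw.sum_eq_one h1
    refine ⟨_, image_mem_cliqueTriangulation_faces.2 ⟨?_, hs⟩,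
      mem_convexHull_image_productVertex.2 ⟨w, hw, hw1, hws⟩⟩
    rw [Finset.nonempty_iff_ne_empty]
    rintro rfl
    simp [hws] at hw1

theorem isSimplicialSubdivision_cliqueTriangulation (ε : Bool) :
    IsSimplicialSubdivision (cliqueTriangulation ε) productCells := by
  refine ⟨cliqueTriangulation_space ε, ?_⟩
  rintro _ ⟨s, ⟨-, ⟨a, ha⟩, ⟨b, hb⟩, -⟩, rfl⟩
  have hne : ∀ a : Fin 4, ({a}ᶜ : Finset (Fin 4)).Nonempty ∧
      ({a}ᶜ : Finset (Fin 4)) ≠ Finset.univ := by decide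
  refine ⟨_, ⟨{a}ᶜ, {b}ᶜ, (hne a).1, (hne a).2, (hne b).1, (hne b).2, rfl⟩, fun p hp => ?_⟩
  obtain ⟨w, hw, hw1, hws⟩ := mem_convexHull_image_productVertex.1 hp
  obtain ⟨h1, h2⟩ := hw.mem_stdSimplex hw1
  refine ⟨⟨h1, fun i hi => ?_⟩, h2, fun j hj => ?_⟩
  · rw [← hw.row]
    exact Finset.sum_eq_zero fun j _ => hws _ fun h => hi (by simpa using ha _ h)
  · rw [← hw.col]
    exact Finset.sum_eq_zero fun i _ => hws _ fun h => hj (by simpa using hb _ h)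

theorem encard_range_productVertex : (Set.range productVertex).encard = 16 := by
  rw [← Set.image_univ, productVertex_injective.encard_image, Set.encard_univ]
  simp

theorem isCellClique_singleton (ε : Bool) (v : Fin 4 × Fin 4) : IsCellClique ε {v} := by
  have h : ∀ i : Fin 4, ∃ a, i ≠ a := by decide
  simpa [IsCellClique, adj] using ⟨h v.1, h v.2⟩

theorem cliqueTriangulation_vertices (ε : Bool) :
    (cliqueTriangulation ε).vertices = Set.range productVertex := by
  ext x
  constructor
  · rintro ⟨s, -, hs⟩
    have hx : x ∈ s.image productVertex := by
      rw [show s.image productVertex = {x} from hs]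
      exact Finset.mem_singleton_self x
    obtain ⟨v, -, rfl⟩ := Finset.mem_image.1 hx
    exact ⟨v, rfl⟩
  · rintro ⟨v, rfl⟩
    exact ⟨{v}, ⟨Finset.singleton_nonempty v, isCellClique_singleton ε v⟩, rfl⟩

/-! ### The flip -/

theorem coordinateFlip_productVertex (v : Fin 4 × Fin 4) :
    coordinateFlip (productVertex v) = productVertex v.swap := rfl

theorem image_coordinateFlip_image_productVertex (s : Finset (Fin 4 × Fin 4)) :
    (s.image productVertex).image coordinateFlip = (s.image Prod.swap).image productVertex := by
  simp only [Finset.image_image]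
  rfl

theorem mem_zpowers_coordinateFlip
    {g : Equiv.Perm ((Fin 4 → ℝ) × (Fin 4 → ℝ))} :
    g ∈ Subgroup.zpowers coordinateFlip ↔ g = 1 ∨ g = coordinateFlip := by
  constructor
  · rintro ⟨n, rfl⟩
    have h2 : coordinateFlip ^ (2 : ℤ) = 1 := Equiv.ext fun p => rfl
    obtain ⟨m, rfl | rfl⟩ := Int.even_or_odd' n
    · left
      simp only [zpow_mul, h2, one_zpow]
    · right
      simp only [zpow_add, zpow_mul, h2, one_zpow, one_mul, zpow_one]
  · rintro (rfl | rfl)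
    · exact one_mem _
    · exact Subgroup.mem_zpowers _

theorem isSimplicialAutomorphism_one {V : Type*} [DecidableEq V]
    (X : PreAbstractSimplicialComplex V) : IsSimplicialAutomorphism X 1 := by
  ext s
  change s ∈ (fun s : Finset V => s.image id) '' X.faces ↔ s ∈ X.faces
  simp

theorem isSimplicialAutomorphism_cliqueTriangulation (ε : Bool) :
    IsSimplicialAutomorphism (cliqueTriangulation ε).toPreAbstractSimplicialComplex
      coordinateFlip := by
  ext x
  constructor
  · rintro ⟨_, ⟨s, hs, rfl⟩, rfl⟩
    exact ⟨s.image Prod.swap, ⟨hs.1.image _, hs.2.image_swap⟩,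
      (image_coordinateFlip_image_productVertex s).symm⟩
  · rintro ⟨s, hs, rfl⟩
    refine ⟨_, ⟨s.image Prod.swap, ⟨hs.1.image _, hs.2.image_swap⟩, rfl⟩, ?_⟩
    change ((s.image Prod.swap).image productVertex).image coordinateFlip = _
    have hss : (s.image Prod.swap).image Prod.swap = s := by
      rw [Finset.image_image, Prod.swap_swap_eq, Finset.image_id]
    rw [image_coordinateFlip_image_productVertex, hss]

theorem isPureAction_cliqueTriangulation (ε : Bool) :
    IsPureAction (Subgroup.zpowers coordinateFlip)
      (cliqueTriangulation ε).toPreAbstractSimplicialComplex where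
  automorphism g hg := by
    rcases mem_zpowers_coordinateFlip.1 hg with rfl | rfl
    · exact isSimplicialAutomorphism_one _
    · exact isSimplicialAutomorphism_cliqueTriangulation ε
  not_edge := by
    rintro u hu v - huv ⟨g, hg, rfl⟩ hface
    obtain ⟨u, rfl⟩ := (cliqueTriangulation_vertices ε).subset hu
    rcases mem_zpowers_coordinateFlip.1 hg with rfl | rfl
    · exact huv rfl
    · rw [coordinateFlip_productVertex] at huv hface
      rw [← Finset.image_singleton, ← Finset.image_insert, image_mem_cliqueTriangulation_faces]
        at hface
      have := hface.2.2.2 u (by simp) u.swap (by simp)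
      rw [not_adj_swap_self ε u fun h => huv (by rw [h])] at this
      exact Bool.false_ne_true this
  transitive := by
    rintro s hs u ⟨hus, hu⟩ v ⟨hvs, hv⟩ ⟨g, hg, rfl⟩
    by_cases hgu : g u = u
    · exact ⟨1, one_mem _, Finset.image_id, hgu.symm⟩
    rcases mem_zpowers_coordinateFlip.1 hg with rfl | rfl
    · exact absurd rfl hgu
    refine ⟨_, hg, ?_, rfl⟩
    obtain ⟨t, ht, hts⟩ := hu
    change t.image productVertex = insert u s at hts
    obtain ⟨u, -, rfl⟩ : ∃ u' ∈ t, productVertex u' = u :=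
      Finset.mem_image.1 (hts ▸ Finset.mem_insert_self u s)
    obtain ⟨s, -, rfl⟩ : ∃ s' ⊆ t, s'.image productVertex = s := by
      have : s ⊆ t.image productVertex := hts ▸ Finset.subset_insert _ s
      obtain ⟨s', hs', h⟩ := Finset.subset_image_iff.1 this
      exact ⟨s', hs', h⟩
    rw [coordinateFlip_productVertex] at hgu hv hvs
    have htu : IsCellClique ε (insert u s) := by
      rw [← Finset.image_insert] at hts
      rw [← Finset.image_injective productVertex_injective hts]
      exact ht.2
    have htv : IsCellClique ε (insert u.swap s) := by
      rw [← Finset.image_insert] at hv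
      exact (image_mem_cliqueTriangulation_faces.1 hv).2
    -- A simplex joined to both `u` and its flip lies on the diagonal.
    have hdiag : ∀ w ∈ s, w.swap = w := fun w hw => isDiag_of_adj ε w u
      (fun h => hgu (by rw [h]))
      (fun h => hus (Finset.mem_image_of_mem _ (h ▸ hw)))
      (fun h => hvs (Finset.mem_image_of_mem _ (h ▸ hw)))
      (htu.2.2 w (Finset.mem_insert_of_mem hw) u (Finset.mem_insert_self _ _))
      (htv.2.2 w (Finset.mem_insert_of_mem hw) u.swap (Finset.mem_insert_self _ _))
    rw [image_coordinateFlip_image_productVertex]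
    congr 1
    rw [Finset.image_congr (g := id) fun w hw => hdiag w hw, Finset.image_id]

/-! ### Isomorphism and distinctness -/

theorem IsCellClique.image_prodMap_swap {ε : Bool} {s : Finset (Fin 4 × Fin 4)}
    (hs : IsCellClique ε s) :
    IsCellClique (!ε) (s.image (Prod.map (Equiv.swap 0 1) (Equiv.swap 0 1))) := by
  obtain ⟨⟨a, ha⟩, ⟨b, hb⟩, h⟩ := hs
  simp only [IsCellClique, Finset.forall_mem_image, Prod.map_fst, Prod.map_snd, adj_prodMap_swap,
    Bool.not_not]
  exact ⟨⟨Equiv.swap 0 1 a, fun v hv => by simpa using ha v hv⟩,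
    ⟨Equiv.swap 0 1 b, fun v hv => by simpa using hb v hv⟩, fun u hu v hv => h u hu v hv⟩

theorem map_cliqueTriangulation (ε : Bool) :
    (cliqueTriangulation ε).toPreAbstractSimplicialComplex.map
      (fun p => (p.1 ∘ Equiv.swap 0 1, p.2 ∘ Equiv.swap 0 1)) =
      (cliqueTriangulation (!ε)).toPreAbstractSimplicialComplex := by
  have hsingle : ∀ i : Fin 4, (Pi.single i 1 : Fin 4 → ℝ) ∘ Equiv.swap 0 1 =
      Pi.single (Equiv.swap 0 1 i) 1 := by
    intro i
    ext j
    simp only [Function.comp_apply, Pi.single_apply, ← Equiv.eq_symm_apply, Equiv.symm_swap]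

  have himage : ∀ s : Finset (Fin 4 × Fin 4), (s.image productVertex).image
      (fun p : (Fin 4 → ℝ) × (Fin 4 → ℝ) => (p.1 ∘ Equiv.swap 0 1, p.2 ∘ Equiv.swap 0 1)) =
      (s.image (Prod.map (Equiv.swap 0 1) (Equiv.swap 0 1))).image productVertex := by
    intro s
    rw [Finset.image_image, Finset.image_image]
    exact Finset.image_congr fun v _ => Prod.ext (hsingle v.1) (hsingle v.2)
  ext x
  constructor
  · rintro ⟨_, ⟨s, hs, rfl⟩, rfl⟩
    exact ⟨_, ⟨hs.1.image _, hs.2.image_prodMap_swap⟩, (himage s).symm⟩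
  · rintro ⟨s, hs, rfl⟩
    refine ⟨_, ⟨s.image (Prod.map (Equiv.swap 0 1) (Equiv.swap 0 1)), ⟨hs.1.image _, ?_⟩, rfl⟩, ?_⟩
    · simpa using hs.2.image_prodMap_swap
    · refine (himage _).trans ?_
      have hid : Prod.map (Equiv.swap 0 1) (Equiv.swap 0 1) ∘
          Prod.map (Equiv.swap 0 1) (Equiv.swap 0 1) = (id : Fin 4 × Fin 4 → Fin 4 × Fin 4) := by
        ext v <;> simp
      exact congrArg _ (by rw [Finset.image_image, hid, Finset.image_id])

theorem isIsomorphic_cliqueTriangulation (ε : Bool) :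
    IsIsomorphic (cliqueTriangulation ε).toPreAbstractSimplicialComplex
      (cliqueTriangulation (!ε)).toPreAbstractSimplicialComplex := by
  refine ⟨_, Function.Injective.injOn fun p q h => ?_, map_cliqueTriangulation ε⟩
  rw [Prod.mk.injEq] at h
  exact Prod.ext ((Equiv.swap 0 1).surjective.injective_comp_right h.1)
    ((Equiv.swap 0 1).surjective.injective_comp_right h.2)

theorem cliqueTriangulation_true_ne_false : cliqueTriangulation true ≠ cliqueTriangulation false := by
  intro h
  have h1 : ({(0, 1), (2, 3)} : Finset (Fin 4 × Fin 4)).image productVertex ∈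
      (cliqueTriangulation true).faces :=
    image_mem_cliqueTriangulation_faces.2 (by decide +kernel)
  rw [h, image_mem_cliqueTriangulation_faces] at h1
  revert h1
  decide +kernel

/-! ### Uniqueness -/

/-- Product vertices are extreme: the functional `y ↦ y.1 i + y.2 j` is less than `2` at every other
point of the product of the simplices. -/
theorem mem_of_productVertex_mem_convexHull {s : Finset ((Fin 4 → ℝ) × (Fin 4 → ℝ))}
    (hs : ∀ y ∈ s, y.1 ∈ stdSimplex ℝ (Fin 4) ∧ y.2 ∈ stdSimplex ℝ (Fin 4)) {v : Fin 4 × Fin 4}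
    (hv : productVertex v ∈ convexHull ℝ (s : Set ((Fin 4 → ℝ) × (Fin 4 → ℝ)))) :
    productVertex v ∈ s := by
  have heq : ∀ x ∈ stdSimplex ℝ (Fin 4), ∀ i, 1 ≤ x i → x = Pi.single i 1 := by
    intro x hx i hi
    have hsum := hx.2
    rw [← Finset.add_sum_erase _ _ (Finset.mem_univ i)] at hsum
    have hnn : 0 ≤ ∑ j ∈ Finset.univ.erase i, x j := Finset.sum_nonneg fun j _ => hx.1 j
    have h0 := (Finset.sum_eq_zero_iff_of_nonneg (s := Finset.univ.erase i)
      fun j _ => hx.1 j).1 (by linarith)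
    ext j
    by_cases hj : j = i
    · subst hj
      rw [Pi.single_eq_same]
      linarith
    · rw [Pi.single_eq_of_ne hj, h0 j (by simpa using hj)]
  by_contra hvs
  have hlt : ∀ y ∈ s, y.1 v.1 + y.2 v.2 < 2 := by
    intro y hy
    obtain ⟨h1, h2⟩ := hs y hy
    have hle : ∀ x ∈ stdSimplex ℝ (Fin 4), ∀ i, x i ≤ 1 := fun x hx i => by
      rw [← hx.2]
      exact Finset.single_le_sum (fun j _ => hx.1 j) (Finset.mem_univ i)
    have := hle _ h1 v.1
    have := hle _ h2 v.2
    by_contra hcon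
    refine hvs ?_
    have : y = productVertex v :=
      Prod.ext (heq _ h1 v.1 (by linarith)) (heq _ h2 v.2 (by linarith))
    exact this ▸ hy
  have hconv : Convex ℝ {y : (Fin 4 → ℝ) × (Fin 4 → ℝ) | y.1 v.1 + y.2 v.2 < 2} :=
    convex_halfSpace_lt (f := fun y : (Fin 4 → ℝ) × (Fin 4 → ℝ) => y.1 v.1 + y.2 v.2)
      ⟨fun x y => by simp only [Prod.fst_add, Prod.snd_add, Pi.add_apply]; ring,
        fun c x => by simp only [Prod.smul_fst, Prod.smul_snd, Pi.smul_apply, smul_eq_mul]; ring⟩ 2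
  have : productVertex v ∈ {y : (Fin 4 → ℝ) × (Fin 4 → ℝ) | y.1 v.1 + y.2 v.2 < 2} :=
    convexHull_min hlt hconv hv
  simp only [productVertex, Set.mem_ofPred_eq, Pi.single_eq_same] at this
  norm_num at this

section

variable {K : Geometry.SimplicialComplex ℝ ((Fin 4 → ℝ) × (Fin 4 → ℝ))}

theorem IsSimplicialSubdivision.vertices_eq (hK : IsSimplicialSubdivision K productCells)
    (hcard : K.vertices.encard = 16) : K.vertices = Set.range productVertex := by
  symm
  refine (Set.finite_range productVertex).eq_of_subset_of_encard_le ?_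
    (hcard.trans encard_range_productVertex.symm).le
  rintro _ ⟨v, rfl⟩
  have hne : ∀ i : Fin 4, ∃ a, a ≠ i := by decide
  have hmem : productVertex v ∈ K.space := by
    rw [hK.1, mem_sUnion_productCells]
    obtain ⟨a, ha⟩ := hne v.1
    obtain ⟨b, hb⟩ := hne v.2
    exact ⟨⟨single_mem_stdSimplex ℝ v.1, a, Pi.single_eq_of_ne ha _⟩,
      single_mem_stdSimplex ℝ v.2, b, Pi.single_eq_of_ne hb _⟩
  obtain ⟨s, hs, hvs⟩ := Geometry.SimplicialComplex.mem_space_iff.1 hmem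
  refine K.down_closed hs (Finset.singleton_subset_iff.2
    (mem_of_productVertex_mem_convexHull (fun y hy => ?_) hvs)) (Finset.singleton_nonempty _)
  obtain ⟨c, ⟨A, B, -, -, -, -, rfl⟩, hc⟩ := hK.2 s hs
  have := hc (subset_convexHull ℝ _ hy)
  exact ⟨this.1.1, this.2.1⟩

theorem exists_image_productVertex_eq (hV : K.vertices = Set.range productVertex)
    {s : Finset ((Fin 4 → ℝ) × (Fin 4 → ℝ))} (hs : s ∈ K.faces) :
    ∃ t : Finset (Fin 4 × Fin 4), t.image productVertex = s := by
  have : (s : Set _) ⊆ Set.range productVertex := fun x hx => by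
    rw [← hV]
    exact K.down_closed hs (Finset.singleton_subset_iff.2 hx) (Finset.singleton_nonempty _)
  rw [← Set.image_univ, ← Finset.coe_univ] at this
  obtain ⟨t, -, ht⟩ := Finset.subset_set_image_iff.1 this
  exact ⟨t, ht⟩

/-- The product vertices with indices `u` and `v` span a simplex of `K` (a vertex if `u = v`). -/
def IsEdge (K : Geometry.SimplicialComplex ℝ ((Fin 4 → ℝ) × (Fin 4 → ℝ)))
    (u v : Fin 4 × Fin 4) : Prop :=
  ({productVertex u, productVertex v} : Finset _) ∈ K.faces

theorem IsEdge.symm {u v : Fin 4 × Fin 4} (h : IsEdge K u v) : IsEdge K v u := by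
  rwa [IsEdge, Finset.pair_comm]

/-- One of the diagonals of a square is an edge, since the centre of the square is covered. For
`j = l` the square degenerates to a segment, and the lemma says that the segment is an edge. -/
theorem isEdge_or_isEdge (hspace : K.space = ⋃₀ productCells)
    (hV : K.vertices = Set.range productVertex) {i k j l : Fin 4} (hik : i ≠ k) :
    IsEdge K (i, j) (k, l) ∨ IsEdge K (i, l) (k, j) := by
  let f : Fin 4 → Fin 4 → Fin 4 → ℝ := fun i k => Pi.single i (1 / 2) + Pi.single k (1 / 2)
  have hf : ∀ i k, f i k ∈ stdSimplex ℝ (Fin 4) := by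
    intro i k
    refine ⟨fun x => ?_, ?_⟩
    · simp only [f, Pi.add_apply, Pi.single_apply]
      split_ifs <;> norm_num
    · simp only [f, Pi.add_apply, Finset.sum_add_distrib, Finset.sum_pi_single', Finset.mem_univ,
        if_true]
      norm_num
  have hf0 : ∀ i k x, x ≠ i → x ≠ k → f i k x = 0 := by
    intro i k x hi hk
    simp [f, hi, hk]
  have hne : ∀ i k : Fin 4, ∃ a, a ≠ i ∧ a ≠ k := by decide
  have hmem : (f i k, f j l) ∈ K.space := by
    rw [hspace, mem_sUnion_productCells]
    obtain ⟨a, ha, ha'⟩ := hne i k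
    obtain ⟨b, hb, hb'⟩ := hne j l
    exact ⟨⟨hf i k, a, hf0 _ _ _ ha ha'⟩, hf j l, b, hf0 _ _ _ hb hb'⟩
  obtain ⟨s, hs, hp⟩ := Geometry.SimplicialComplex.mem_space_iff.1 hmem
  obtain ⟨t, rfl⟩ := exists_image_productVertex_eq hV hs
  obtain ⟨w, hw, -, hwt⟩ := mem_convexHull_image_productVertex.1 hp
  have hedge : ∀ u v, w u ≠ 0 → w v ≠ 0 → IsEdge K u v := by
    intro u v hu hv
    refine K.down_closed hs ?_ (Finset.insert_nonempty _ _)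
    simp only [Finset.insert_subset_iff, Finset.singleton_subset_iff]
    exact ⟨Finset.mem_image_of_mem _ (by_contra fun h => hu (hwt u h)),
      Finset.mem_image_of_mem _ (by_contra fun h => hv (hwt v h))⟩
  have h0 : ∀ x y, y ≠ j → y ≠ l → w (x, y) = 0 := fun x y hj hl =>
    hw.eq_zero_of_snd (hf0 _ _ _ hj hl) x
  have h0' : ∀ x y, x ≠ i → x ≠ k → w (x, y) = 0 := fun x y hi hk =>
    hw.eq_zero_of_fst (hf0 _ _ _ hi hk) y
  have hri : ∑ y, w (i, y) = 1 / 2 := by rw [hw.row]; simp [f, hik]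
  have hrk : ∑ y, w (k, y) = 1 / 2 := by rw [hw.row]; simp [f, hik.symm]
  by_cases hjl : j = l
  · subst hjl
    left
    apply hedge
    · rw [Fintype.sum_eq_single j fun y hy => h0 i y hy hy] at hri
      rw [hri]; norm_num
    · rw [Fintype.sum_eq_single j fun y hy => h0 k y hy hy] at hrk
      rw [hrk]; norm_num
  · rw [Fintype.sum_eq_add j l hjl fun y hy => h0 i y hy.1 hy.2] at hri
    rw [Fintype.sum_eq_add j l hjl fun y hy => h0 k y hy.1 hy.2] at hrk
    have hcj : ∑ x, w (x, j) = 1 / 2 := by rw [hw.col]; simp [f, hjl]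
    rw [Fintype.sum_eq_add i k hik fun x hx => h0' x j hx.1 hx.2] at hcj
    by_cases hij : w (i, j) = 0
    · right
      apply hedge <;> intro h <;> linarith
    · left
      apply hedge _ _ hij
      intro h
      apply hij
      linarith

theorem IsEdge.swap (hflip : IsSimplicialAutomorphism K.toPreAbstractSimplicialComplex coordinateFlip)
    {u v : Fin 4 × Fin 4} (h : IsEdge K u v) : IsEdge K u.swap v.swap := by
  unfold IsSimplicialAutomorphism at hflip
  have hmem : ({productVertex u, productVertex v} : Finset _).image coordinateFlip ∈
      (K.toPreAbstractSimplicialComplex.map coordinateFlip).faces := ⟨_, h, rfl⟩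
  rw [hflip, Finset.image_insert, Finset.image_singleton] at hmem
  exact hmem

theorem not_isEdge_swap
    (hpure : IsPureAction (Subgroup.zpowers coordinateFlip) K.toPreAbstractSimplicialComplex)
    (hV : K.vertices = Set.range productVertex) {u : Fin 4 × Fin 4} (hu : u.swap ≠ u) :
    ¬ IsEdge K u u.swap :=
  hpure.not_edge _ (hV.symm.subset ⟨u, rfl⟩) _ (hV.symm.subset ⟨u.swap, rfl⟩)
    (fun h => hu (productVertex_injective h).symm)
    ⟨coordinateFlip, Subgroup.mem_zpowers _, rfl⟩

/-- Purity at the vertex `w`: off the diagonal, the stabiliser of `w` is trivial. -/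
theorem not_isEdge_of_isEdge
    (hpure : IsPureAction (Subgroup.zpowers coordinateFlip) K.toPreAbstractSimplicialComplex)
    (hV : K.vertices = Set.range productVertex) {u w : Fin 4 × Fin 4} (hu : u.swap ≠ u)
    (hw : w.swap ≠ w) (hwu : w ≠ u) (hwu' : w ≠ u.swap) (h : IsEdge K w u) :
    ¬ IsEdge K w u.swap := by
  intro h'
  have hlink : ∀ v, w ≠ v → IsEdge K w v → productVertex v ∈
      linkVertices K.toPreAbstractSimplicialComplex {productVertex w} := fun v hv hwv =>
    ⟨by simpa using fun h => hv (productVertex_injective h).symm, hwv.symm⟩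
  obtain ⟨g, hg, hgs, hgu⟩ := hpure.transitive {productVertex w}
    (Or.inr (hV.symm.subset ⟨w, rfl⟩)) _ (hlink u hwu h) _ (hlink u.swap hwu' h')
    ⟨coordinateFlip, Subgroup.mem_zpowers _, rfl⟩
  rcases mem_zpowers_coordinateFlip.1 hg with rfl | rfl
  · exact hu (productVertex_injective hgu).symm
  · rw [Finset.image_singleton, Finset.singleton_inj] at hgs
    exact hw (productVertex_injective hgs)

/-- The three ways of not being joined in `adj ε`. -/
theorem of_adj_eq_false : ∀ (ε : Bool) (i j k l : Fin 4),
    adj ε (i, j) (k, l) = false → (i ≠ k ∧ j ≠ l ∧ i ≠ j ∧ k ≠ l) ∧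
      (i = l ∨ j = k ∨ (i ≠ l ∧ j ≠ k ∧ evenIndices i j k l = !ε)) := by
  decide +kernel

/-- The alternating group on the four positions is generated by a 3-cycle and the double
transpositions, so a property of quadruples stable under these depends only on the parity. -/
theorem forall_of_evenIndices_eq {P : Fin 4 → Fin 4 → Fin 4 → Fin 4 → Prop}
    (hcyc : ∀ i j k l, [i, j, k, l].Nodup → P i j k l → P j l k i)
    (hsymm : ∀ i j k l, P i j k l → P k l i j) (hswap : ∀ i j k l, P i j k l → P j i l k)
    {a b c d : Fin 4} (habcd : [a, b, c, d].Nodup) (h : P a b c d) {i j k l : Fin 4}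
    (hijkl : [i, j, k, l].Nodup) (heven : evenIndices i j k l = evenIndices a b c d) :
    P i j k l := by
  have hnodup : ∀ i j k l : Fin 4, [i, j, k, l].Nodup → [j, l, k, i].Nodup := by decide +kernel
  have h1 := hcyc _ _ _ _ habcd h
  have h2 := hcyc _ _ _ _ (hnodup _ _ _ _ habcd) h1
  have key : ∀ a b c d : Fin 4, [a, b, c, d].Nodup → ∀ i j k l : Fin 4, [i, j, k, l].Nodup →
      evenIndices i j k l = evenIndices a b c d →
      (i, j, k, l) ∈ [(a, b, c, d), (b, a, d, c), (c, d, a, b), (d, c, b, a),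
        (b, d, c, a), (d, b, a, c), (c, a, b, d), (a, c, d, b),
        (d, a, c, b), (a, d, b, c), (c, b, d, a), (b, c, a, d)] := by
    decide +kernel
  have hklein : ∀ p q r s, P p q r s → P p q r s ∧ P q p s r ∧ P r s p q ∧ P s r q p :=
    fun p q r s hp => ⟨hp, hswap _ _ _ _ hp, hsymm _ _ _ _ hp, hswap _ _ _ _ (hsymm _ _ _ _ hp)⟩
  have hmem := key a b c d habcd i j k l hijkl heven
  obtain ⟨a1, a2, a3, a4⟩ := hklein _ _ _ _ h
  obtain ⟨b1, b2, b3, b4⟩ := hklein _ _ _ _ h1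
  obtain ⟨c1, c2, c3, c4⟩ := hklein _ _ _ _ h2
  simp only [List.mem_cons, Prod.mk.injEq, List.not_mem_nil, or_false] at hmem
  rcases hmem with ⟨rfl, rfl, rfl, rfl⟩ | ⟨rfl, rfl, rfl, rfl⟩ | ⟨rfl, rfl, rfl, rfl⟩ |
    ⟨rfl, rfl, rfl, rfl⟩ | ⟨rfl, rfl, rfl, rfl⟩ | ⟨rfl, rfl, rfl, rfl⟩ | ⟨rfl, rfl, rfl, rfl⟩ |
    ⟨rfl, rfl, rfl, rfl⟩ | ⟨rfl, rfl, rfl, rfl⟩ | ⟨rfl, rfl, rfl, rfl⟩ | ⟨rfl, rfl, rfl, rfl⟩ |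
    ⟨rfl, rfl, rfl, rfl⟩
  exacts [a1, a2, a3, a4, b1, b2, b3, b4, c1, c2, c3, c4]

/-- The edges of a pure subdivision follow one of the two graphs; the parity is read off from the
square `{0, 2} × {1, 3}`. -/
theorem exists_forall_isEdge_adj (hspace : K.space = ⋃₀ productCells)
    (hV : K.vertices = Set.range productVertex)
    (hflip : IsSimplicialAutomorphism K.toPreAbstractSimplicialComplex coordinateFlip)
    (hpure : IsPureAction (Subgroup.zpowers coordinateFlip) K.toPreAbstractSimplicialComplex) :
    ∃ ε, ∀ u v, IsEdge K u v → adj ε u v = true := by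
  have hcyc : ∀ i j k l, [i, j, k, l].Nodup →
      IsEdge K (i, j) (k, l) → ¬ IsEdge K (j, i) (k, l) ∧ IsEdge K (j, l) (k, i) := by
    intro i j k l hnodup h
    simp only [List.nodup_cons, List.mem_cons, List.not_mem_nil, or_false, not_or] at hnodup
    obtain ⟨⟨hij, hik, hil⟩, ⟨hjk, hjl⟩, hkl, -⟩ := hnodup
    have hn : ¬ IsEdge K (j, i) (k, l) := fun h' =>
      not_isEdge_of_isEdge hpure hV (u := (i, j)) (w := (k, l)) (by simp [Ne.symm hij])
        (by simp [Ne.symm hkl]) (by simp [Ne.symm hik]) (by simp [Ne.symm hjk]) h.symm h'.symm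
    exact ⟨hn, (isEdge_or_isEdge hspace hV hjk).resolve_left hn⟩
  -- The segment between `x_{ki}` and `x_{ji}` is an edge, and `x_{ij}` is the flip of `x_{ji}`.
  have hmixed : ∀ i j k, i ≠ j → i ≠ k → j ≠ k → ¬ IsEdge K (i, j) (k, i) := by
    intro i j k hij hik hjk h
    have hji : IsEdge K (k, i) (j, i) := by
      simpa using isEdge_or_isEdge hspace hV (i := k) (k := j) (j := i) (l := i) hjk.symm
    exact not_isEdge_of_isEdge hpure hV (u := (i, j)) (w := (k, i)) (by simp [hij.symm])
      (by simp [hik]) (by simp [hik.symm]) (by simp [hjk.symm]) h.symm hji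
  have hdiag : ∀ i j, i ≠ j → ¬ IsEdge K (i, j) (j, i) := fun i j hij =>
    not_isEdge_swap hpure hV (u := (i, j)) (by simp [hij.symm])
  obtain ⟨ε, hε⟩ : ∃ ε, IsEdge K (0, 1) (2, 3) ∧ ε = true ∨ IsEdge K (0, 3) (2, 1) ∧ ε = false := by
    rcases isEdge_or_isEdge hspace hV (i := 0) (k := 2) (j := 1) (l := 3) (by decide) with h | h
    exacts [⟨true, Or.inl ⟨h, rfl⟩⟩, ⟨false, Or.inr ⟨h, rfl⟩⟩]
  have hall : ∀ i j k l : Fin 4, [i, j, k, l].Nodup → evenIndices i j k l = ε →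
      IsEdge K (i, j) (k, l) := by
    intro i j k l hnodup he
    rcases hε with ⟨h, rfl⟩ | ⟨h, rfl⟩ <;>
    exact forall_of_evenIndices_eq (P := fun i j k l => IsEdge K (i, j) (k, l))
      (fun i j k l hn h => (hcyc i j k l hn h).2) (fun i j k l h => h.symm)
      (fun i j k l h => IsEdge.swap hflip h) (by decide) h hnodup (he.trans (by decide +kernel))
  refine ⟨ε, ?_⟩
  rintro ⟨i, j⟩ ⟨k, l⟩ h
  by_contra hadj
  obtain ⟨⟨hik, hjl, hij, hkl⟩, hcase⟩ := of_adj_eq_false ε i j k l (by simpa using hadj)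
  by_cases hil : i = l
  · subst hil
    by_cases hjk : j = k
    · subst hjk
      exact hdiag _ _ hij h
    · exact hmixed _ _ _ hij hik hjk h
  by_cases hjk : j = k
  · subst hjk
    exact hmixed _ _ _ hjl hij.symm (Ne.symm hil) h.symm
  have heven : evenIndices i j k l = !ε := by tauto
  have hodd : ∀ (ε : Bool) (i j k l : Fin 4), i ≠ j → evenIndices i j k l = !ε →
      evenIndices j i k l = ε := by decide +kernel
  have hnodup : [j, i, k, l].Nodup := by simp [hij.symm, hjk, hjl, hik, hil, hkl]
  exact (hcyc j i k l hnodup (hall j i k l hnodup (hodd ε i j k l hij heven))).1 h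

theorem faces_subset_cliqueTriangulation (hK : IsSimplicialSubdivision K productCells)
    (hV : K.vertices = Set.range productVertex) {ε : Bool}
    (hε : ∀ u v, IsEdge K u v → adj ε u v = true) :
    K.faces ⊆ (cliqueTriangulation ε).faces := by
  intro x hx
  obtain ⟨s, rfl⟩ := exists_image_productVertex_eq hV hx
  refine image_mem_cliqueTriangulation_faces.2
    ⟨Finset.image_nonempty.1 (K.nonempty_of_mem_faces hx), ?_⟩
  obtain ⟨c, ⟨A, B, -, hA, -, hB, rfl⟩, hc⟩ := hK.2 _ hx
  obtain ⟨a, ha⟩ := not_forall.1 (mt Finset.eq_univ_iff_forall.2 hA)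
  obtain ⟨b, hb⟩ := not_forall.1 (mt Finset.eq_univ_iff_forall.2 hB)
  have hcell : ∀ v ∈ s, productVertex v ∈ simplexCarrier A ×ˢ simplexCarrier B := fun v hv =>
    hc (subset_convexHull ℝ _ (Finset.mem_coe.2 (Finset.mem_image_of_mem _ hv)))
  refine ⟨⟨a, ?_⟩, ⟨b, ?_⟩, fun u hu v hv => hε u v (K.down_closed hx ?_ (by simp))⟩
  · rintro v hv rfl
    simpa [productVertex] using (hcell v hv).1.2 _ ha
  · rintro v hv rfl
    simpa [productVertex] using (hcell v hv).2.2 _ hb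
  · simp only [Finset.insert_subset_iff, Finset.singleton_subset_iff]
    exact ⟨Finset.mem_image_of_mem _ hu, Finset.mem_image_of_mem _ hv⟩

/-- A subcomplex with the same carrier is the whole complex. -/
theorem eq_cliqueTriangulation (hspace : K.space = ⋃₀ productCells) {ε : Bool}
    (hsub : K.faces ⊆ (cliqueTriangulation ε).faces) : K = cliqueTriangulation ε := by
  have hfaces : K.faces = (cliqueTriangulation ε).faces := by
    refine hsub.antisymm ?_
    rintro _ ⟨s, hs, rfl⟩
    -- The barycentre of `s` lies in a face of `K`, which must then contain `s`.
    have hpos : (0 : ℝ) < s.card := by exact_mod_cast hs.1.card_pos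
    set w : Fin 4 × Fin 4 → ℝ := fun v => if v ∈ s then (s.card : ℝ)⁻¹ else 0 with hw
    have hwp : IsTransportPlan w (∑ v, w v • productVertex v) := by
      rw [sum_smul_productVertex]
      refine ⟨fun v => ?_, fun _ => rfl, fun _ => rfl⟩
      simp only [hw]
      split_ifs <;> positivity
    have hws : ∀ v ∉ s, w v = 0 := fun v hv => if_neg hv
    have hw1 : ∑ v, w v = 1 := by
      simp only [hw, Finset.sum_ite_mem, Finset.univ_inter, Finset.sum_const, nsmul_eq_mul]
      exact mul_inv_cancel₀ hpos.ne'
    have hmem : ∑ v, w v • productVertex v ∈ K.space := by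
      rw [hspace, ← cliqueTriangulation_space ε, Geometry.SimplicialComplex.mem_space_iff]
      exact ⟨_, image_mem_cliqueTriangulation_faces.2 hs,
        mem_convexHull_image_productVertex.2 ⟨w, hwp, hw1, hws⟩⟩
    obtain ⟨x, hx, hpx⟩ := Geometry.SimplicialComplex.mem_space_iff.1 hmem
    obtain ⟨t, ht, rfl⟩ := hsub hx
    obtain ⟨w', hwp', -, hwt⟩ := mem_convexHull_image_productVertex.1 hpx
    obtain rfl := hwp.eq_of_isCellClique hwp' hs.2 ht.2 hws hwt
    refine K.down_closed hx (Finset.image_subset_image fun v hv => ?_) (hs.1.image _)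
    by_contra hvt
    have := hwt v hvt
    simp only [hw, if_pos hv] at this
    exact (inv_pos.2 hpos).ne' this
  exact Geometry.SimplicialComplex.ext hfaces

end

theorem theorem1 :
    ∃ K₁ K₂ : Geometry.SimplicialComplex ℝ ((Fin 4 → ℝ) × (Fin 4 → ℝ)),
      K₁ ≠ K₂ ∧
      {K : Geometry.SimplicialComplex ℝ ((Fin 4 → ℝ) × (Fin 4 → ℝ)) |
        K.vertices.encard = 16 ∧
        IsSimplicialSubdivision K productCells ∧
        IsSimplicialAutomorphism K.toPreAbstractSimplicialComplex coordinateFlip ∧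
        IsPureAction (Subgroup.zpowers coordinateFlip) K.toPreAbstractSimplicialComplex} =
          {K₁, K₂} ∧
      IsIsomorphic K₁.toPreAbstractSimplicialComplex K₂.toPreAbstractSimplicialComplex ∧
      K₁.toPreAbstractSimplicialComplex = s2s2.map productVertex ∧
      HasFaceVector s2s2 ![16, 84, 216, 240, 96] := by
  refine ⟨cliqueTriangulation true, cliqueTriangulation false, cliqueTriangulation_true_ne_false,
    ?_, isIsomorphic_cliqueTriangulation true, ?_, hasFaceVector_s2s2⟩
  · ext K
    constructor
    · rintro ⟨hcard, hK, hflip, hpure⟩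
      have hV := hK.vertices_eq hcard
      obtain ⟨ε, hε⟩ := exists_forall_isEdge_adj hK.1 hV hflip hpure
      have := eq_cliqueTriangulation hK.1 (faces_subset_cliqueTriangulation hK hV hε)
      cases ε
      exacts [Or.inr this, Or.inl this]
    · have h : ∀ ε, cliqueTriangulation ε ∈
          {K : Geometry.SimplicialComplex ℝ ((Fin 4 → ℝ) × (Fin 4 → ℝ)) |
            K.vertices.encard = 16 ∧ IsSimplicialSubdivision K productCells ∧
            IsSimplicialAutomorphism K.toPreAbstractSimplicialComplex coordinateFlip ∧
            IsPureAction (Subgroup.zpowers coordinateFlip) K.toPreAbstractSimplicialComplex} :=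
        fun ε => ⟨by rw [cliqueTriangulation_vertices, encard_range_productVertex],
          isSimplicialSubdivision_cliqueTriangulation ε,
          isSimplicialAutomorphism_cliqueTriangulation ε, isPureAction_cliqueTriangulation ε⟩
      rintro (rfl | rfl)
      exacts [h true, h false]
  · rw [← cliqueComplex_true]
    rfl
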